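/- In the hexagonal lattice drawn with vertical edges, index the hexagonal cells by pairs $(a,b)$ of integers so that passing from $(a,b)$ to $(a+1,b)$ is a step to the lower-left neighbouring hexagon and passing to $(a,b+1)$ is a step to the lower-right neighbouring hexagon. For integers $n_1,n_2,m_1,m_2\ge 0$ let the ribbon $Rb(n_1,n_2,m_1,m_2)$ be the graph formed by all vertices and edges of the hexagons $(a,b)$ with either $0\le a<n_1+n_2,\ 0\le b<m_1$, or $n_2\le a<n_1+n_2,\ 0\le b<m_1+m_2$; that is, the union of two parallelograms of hexagons, of sizes $(n_1+n_2)\times m_1$ and $n_1\times(m_1+m_2)$, meeting in a common $n_1\times m_1$ corner. A Kekulé structure of a graph $B$ is a spanning subgraph all of whose components are $K_2$; a Clar cover of $B$ is a spanning subgraph each of whose components is $K_2$ or a hexagon $C_6$. Let $K\{B\}$ and $C\{B\}$ be the numbers of Kekulé structures and of Clar covers of $B$, and let $\mathrm{ZZ}(B,x)=\sum_{k=0}^{Cl}c_k x^k$, where $c_k$ is the number of Clar covers of $B$ with exactly $k$ components $C_6$ and $Cl$ is the largest number of components $C_6$ in a Clar cover. Then for $B=Rb(n_1,n_2,m_1,m_2)$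 \[ K\{B\}=\mathrm{ZZ}(B,0)=\sum_{k=0}^{\min(n_1,m_1)}\sum_{j=0}^{m_1-k}\sum_{i=0}^{n_1-k}\binom{m_1-k}{j}\binom{n_2+k}{j}\binom{m_2+k}{i}\binom{n_1-k}{i} \] and \[ C\{B\}=\mathrm{ZZ}(B,1)=\sum_{k=0}^{\min(n_1,m_1)}\sum_{j=0}^{m_1-k}\sum_{i=0}^{n_1-k}\binom{m_1-k}{j}\binom{n_2+k}{j}\binom{m_2+k}{i}\binom{n_1-k}{i}2^{i+j} +\sum_{k=1}^{\min(n_1,m_1)}\sum_{j=0}^{m_1-k}\sum_{i=0}^{n_1-k}\binom{m_1-k}{j}\binom{n_2-1+k}{j}\binom{m_2-1+k}{i}\binom{n_1-k}{i}2^{i+j}. \] -/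

import Mathlib

/-! ### Kekulé structures, Clar covers and the Zhang–Zhang polynomial of a graph

A spanning subgraph of `G : SimpleGraph V` is a graph `H : SimpleGraph V` on the same
vertex set with `H ≤ G`. -/

/-- The component `c` of `H` is a double bond, i.e. a complete graph on two vertices. -/
def IsDoubleBond {V : Type*} {H : SimpleGraph V} (c : H.ConnectedComponent) : Prop :=
  Nonempty (c.toSimpleGraph ≃g SimpleGraph.completeGraph (Fin 2))

/-- The component `c` of `H` is an aromatic sextet, i.e. a cycle on six vertices. -/
def IsSextet {V : Type*} {H : SimpleGraph V} (c : H.ConnectedComponent) : Prop :=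
  Nonempty (c.toSimpleGraph ≃g SimpleGraph.cycleGraph 6)

/-- A Kekulé structure: a spanning subgraph all of whose components are `K₂`. -/
def IsKekule {V : Type*} (G H : SimpleGraph V) : Prop :=
  H ≤ G ∧ ∀ c : H.ConnectedComponent, IsDoubleBond c

/-- A Clar cover: a spanning subgraph all of whose components are `K₂` or hexagons `C₆`. -/
def IsClarCover {V : Type*} (G H : SimpleGraph V) : Prop :=
  H ≤ G ∧ ∀ c : H.ConnectedComponent, IsDoubleBond c ∨ IsSextet c

/-- The order of a Clar cover: the number of its aromatic sextets. -/
noncomputable def clarOrder {V : Type*} (H : SimpleGraph V) : ℕ :=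
  Nat.card {c : H.ConnectedComponent // IsSextet c}

/-- The number of Kekulé structures. -/
noncomputable def numKekule {V : Type*} (G : SimpleGraph V) : ℕ :=
  Nat.card {H : SimpleGraph V // IsKekule G H}

/-- The number of Clar covers. -/
noncomputable def numClarCovers {V : Type*} (G : SimpleGraph V) : ℕ :=
  Nat.card {H : SimpleGraph V // IsClarCover G H}

/-- The number `c_k` of Clar covers of order `k`. -/
noncomputable def numClarCoversOfOrder {V : Type*} (G : SimpleGraph V) (k : ℕ) : ℕ :=
  Nat.card {H : SimpleGraph V // IsClarCover G H ∧ clarOrder H = k}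

/-- The Clar number: the maximal order of a Clar cover. -/
noncomputable def clarNumber {V : Type*} (G : SimpleGraph V) : ℕ :=
  sSup {k | ∃ H : SimpleGraph V, IsClarCover G H ∧ clarOrder H = k}

/-- The Zhang–Zhang polynomial `∑_{k=0}^{Cl} c_k x^k`. -/
noncomputable def zzPolynomial {V : Type*} (G : SimpleGraph V) : Polynomial ℕ :=
  ∑ k ∈ Finset.range (clarNumber G + 1),
    Polynomial.C (numClarCoversOfOrder G k) * Polynomial.X ^ k

/-! ### Benzenoids in the hexagonal lattice

The regular hexagons of the lattice (with two vertical sides, side length `1`) are indexed by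
cells `(a, b)`; the centre of the cell `(a, b)` is `(√3/2 · (b - a), -3/2 · (a + b))`, so that
`a` counts steps down-left and `b` counts steps down-right. Every lattice vertex is the top
vertex of exactly one hexagon or the bottom vertex of exactly one hexagon. -/

/-- `A a b` is the top vertex of the cell `(a, b)`; `B a b` is the bottom vertex of the cell
`(a - 1, b - 1)`, that is, the vertex vertically above `A a b` at distance `1`. -/
inductive HexVertex : Type
  | A (a b : ℕ) : HexVertex
  | B (a b : ℕ) : HexVertex
  deriving DecidableEq

/-- The lattice edges: `A a b` is joined to the vertex `B a b` above it and to the vertices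
`B (a + 1) b` and `B a (b + 1)`, its lower left and lower right neighbours. -/
def honeycomb : SimpleGraph HexVertex :=
  SimpleGraph.fromRel fun u v =>
    ∃ a b : ℕ, u = .A a b ∧ (v = .B a b ∨ v = .B (a + 1) b ∨ v = .B a (b + 1))

/-- The six vertices of the cell `(a, b)`, clockwise from the top. -/
def hexagon (h : ℕ × ℕ) : Finset HexVertex :=
  {.A h.1 h.2, .B h.1 (h.2 + 1), .A h.1 (h.2 + 1),
    .B (h.1 + 1) (h.2 + 1), .A (h.1 + 1) h.2, .B (h.1 + 1) h.2}

/-- The graph formed by the vertices and the edges of the hexagons in the set `S` of cells. -/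
def benzenoid (S : Set (ℕ × ℕ)) : SimpleGraph {v : HexVertex // ∃ h ∈ S, v ∈ hexagon h} where
  Adj u v := honeycomb.Adj u.1 v.1 ∧ ∃ h ∈ S, u.1 ∈ hexagon h ∧ v.1 ∈ hexagon h
  symm := ⟨fun _ _ ⟨e, h, hS, hu, hv⟩ => ⟨e.symm, h, hS, hv, hu⟩⟩
  loopless := ⟨fun _ h => h.1.ne rfl⟩

/-- The cells of the ribbon `Rb(n₁, n₂, m₁, m₂)`: the union of the parallelogram of
`(n₁ + n₂) × m₁` cells running down-left and the parallelogram of `n₁ × (m₁ + m₂)` cells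
running down-right, whose common corner is a parallelogram of `n₁ × m₁` cells. -/
def ribbonCells (n₁ n₂ m₁ m₂ : ℕ) : Set (ℕ × ℕ) :=
  {h | (h.1 < n₂ + n₁ ∧ h.2 < m₁) ∨ (n₂ ≤ h.1 ∧ h.1 < n₂ + n₁ ∧ h.2 < m₁ + m₂)}

/-- The ribbon `Rb(n₁, n₂, m₁, m₂)`. -/
abbrev ribbon (n₁ n₂ m₁ m₂ : ℕ) :
    SimpleGraph {v : HexVertex // ∃ h ∈ ribbonCells n₁ n₂ m₁ m₂, v ∈ hexagon h} :=
  benzenoid (ribbonCells n₁ n₂ m₁ m₂)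

/-!
In a finite graph whose six-cycles are all induced, a Clar cover is a partition of the vertices into
edges and six-cycles, so the Zhang–Zhang polynomial is the partition function in which an edge has
weight `1` and a six-cycle weight `x`; in the honeycomb the six-cycles are exactly the hexagons.

The endpoints `A a b` and `B a b` of a vertical edge share the position `(a, b)`. The top vertex of
the region is matched to its lower left or lower right neighbour or lies in the topmost hexagon,
and the vertical double bonds this forces leave a smaller region of the same kind, with its top at
`(a + 1, b)`, `(a, b + 1)` or `(a + 1, b + 1)`. Clar covers therefore correspond to lattice paths
with unit steps and with diagonal steps of weight `x`; in a parallelogram of hexagons these are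
counted by the weighted Delannoy numbers `∑ j, C(m, j) C(n, j) (1 + x) ^ j`.

The path of a ribbon either meets the antidiagonal through the inner corner `(n₂, m₁)` or jumps over
it by a diagonal step. In both cases the parts of the path before and after the crossing lie in
parallelograms, which gives the two sums of products of Delannoy numbers.
-/

section Delannoy

variable {R : Type*} [CommSemiring R] (x : R)

/-- The weighted Delannoy number, by its binomial formula: the total weight of the lattice paths
from `(0, 0)` to `(n, m)` with unit steps of weight `1` and diagonal steps of weight `x`. -/
def delannoy (n m : ℕ) : R :=
  ∑ j ∈ Finset.range (m + 1), m.choose j * n.choose j * (1 + x) ^ j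

theorem delannoy_eq_sum_range {n m k : ℕ} (h : m < k) :
    delannoy x n m = ∑ j ∈ Finset.range k, m.choose j * n.choose j * (1 + x) ^ j := by
  refine Finset.sum_subset (Finset.range_mono h) fun j _ hj => ?_
  rw [Finset.mem_range, not_lt] at hj
  simp [Nat.choose_eq_zero_of_lt hj]

theorem delannoy_comm (n m : ℕ) : delannoy x n m = delannoy x m n := by
  rw [delannoy_eq_sum_range x (Nat.lt_succ_of_le (Nat.le_add_left m n)),
    delannoy_eq_sum_range x (Nat.lt_succ_of_le (Nat.le_add_right n m))]
  exact Finset.sum_congr rfl fun j _ => by ring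

@[simp]
theorem delannoy_zero_right (n : ℕ) : delannoy x n 0 = 1 := by
  simp [delannoy]

@[simp]
theorem delannoy_zero_left (m : ℕ) : delannoy x 0 m = 1 := by
  rw [delannoy_comm, delannoy_zero_right]

theorem delannoy_succ_succ (n m : ℕ) :
    delannoy x (n + 1) (m + 1) =
      delannoy x n (m + 1) + delannoy x (n + 1) m + x * delannoy x n m := by
  have hboth : (1 + x) * delannoy x n m =
      ∑ j ∈ Finset.range (m + 1), (m.choose j * n.choose j * (1 + x) ^ (j + 1) : R) := by
    rw [delannoy, Finset.mul_sum]
    exact Finset.sum_congr rfl fun j _ => by ring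
  have hnone : delannoy x n m = ∑ j ∈ Finset.range (m + 1),
      (m.choose (j + 1) * n.choose (j + 1) * (1 + x) ^ (j + 1) : R) + 1 := by
    rw [delannoy_eq_sum_range x (k := m + 1 + 1) (by omega), Finset.sum_range_succ']
    simp
  have hleft : delannoy x (n + 1) m = delannoy x n m + ∑ j ∈ Finset.range (m + 1),
      (m.choose (j + 1) * n.choose j * (1 + x) ^ (j + 1) : R) := by
    rw [delannoy_eq_sum_range x (k := m + 1 + 1) (by omega), Finset.sum_range_succ', hnone,
      add_right_comm, ← Finset.sum_add_distrib]
    simp [Nat.choose_succ_succ, mul_add, add_mul, add_comm]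
  have hright : delannoy x n (m + 1) = delannoy x n m + ∑ j ∈ Finset.range (m + 1),
      (m.choose j * n.choose (j + 1) * (1 + x) ^ (j + 1) : R) := by
    rw [delannoy, Finset.sum_range_succ', hnone, add_right_comm, ← Finset.sum_add_distrib]
    simp [Nat.choose_succ_succ, add_mul, add_comm]
  calc delannoy x (n + 1) (m + 1)
      = (1 + x) * delannoy x n m + ∑ j ∈ Finset.range (m + 1),
          (m.choose j * n.choose (j + 1) * (1 + x) ^ (j + 1) : R) +
        ∑ j ∈ Finset.range (m + 1), (m.choose (j + 1) * n.choose j * (1 + x) ^ (j + 1) : R) +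
        delannoy x n m := by
        rw [delannoy, Finset.sum_range_succ', hboth, hnone, ← add_assoc,
          ← Finset.sum_add_distrib, ← Finset.sum_add_distrib, ← Finset.sum_add_distrib]
        congr 1
        · exact Finset.sum_congr rfl fun j _ => by push_cast [Nat.choose_succ_succ]; ring
        · simp
    _ = delannoy x n (m + 1) + delannoy x (n + 1) m + x * delannoy x n m := by
        rw [hleft, hright]
        ring

variable {x} in
theorem eq_delannoy {F : ℕ → ℕ → R} {n m : ℕ} (hout : ∀ a b, n < a ∨ m < b → F a b = 0)
    (hsink : F n m = 1) (hF : ∀ a b, a ≤ n → b ≤ m → (a, b) ≠ (n, m) →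
      F a b = F (a + 1) b + F a (b + 1) + x * F (a + 1) (b + 1)) :
    F 0 0 = delannoy x n m := by
  induction n generalizing F m with
  | zero =>
    induction m generalizing F with
    | zero => rw [hsink, delannoy_zero_right]
    | succ m ihm =>
      have hup := ihm (F := fun a b => F a (b + 1)) (fun a b h => hout _ _ (by omega)) hsink
        fun a b ha hb hab => hF a (b + 1) ha (by omega) (by simpa using hab)
      rw [hF 0 0 le_rfl (by omega) (by simp), hout 1 0 (by omega), hout 1 1 (by omega), hup]
      simp
  | succ n ihn =>
    induction m generalizing F with
    | zero =>
      have hright := ihn (F := fun a b => F (a + 1) b) (fun a b h => hout _ _ (by omega)) hsink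
        fun a b ha hb hab => hF (a + 1) b (by omega) hb (by simpa using hab)
      rw [hF 0 0 (by omega) le_rfl (by simp), hout 0 1 (by omega), hout 1 1 (by omega), hright]
      simp
    | succ m ihm =>
      have hright := ihn (F := fun a b => F (a + 1) b) (fun a b h => hout _ _ (by omega)) hsink
        fun a b ha hb hab => hF (a + 1) b (by omega) hb (by simpa using hab)
      have hup := ihm (F := fun a b => F a (b + 1)) (fun a b h => hout _ _ (by omega)) hsink
        fun a b ha hb hab => hF a (b + 1) ha (by omega) (by simpa using hab)
      have hdiag := ihn (F := fun a b => F (a + 1) (b + 1)) (fun a b h => hout _ _ (by omega))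
        hsink fun a b ha hb hab => hF (a + 1) (b + 1) (by omega) (by omega) (by simpa using hab)
      rw [hF 0 0 (by omega) (by omega) (by simp), hright, hup, hdiag, delannoy_succ_succ]

open Finset.HasAntidiagonal (antidiagonal)

variable {x} in
/-- Paths are split according to whether they meet the antidiagonal `a + b = d + 1` or jump over
it by a diagonal step. -/
theorem eq_sum_antidiagonal_delannoy {F : ℕ → ℕ → R} {d : ℕ}
    (hF : ∀ a b, a + b ≤ d → F a b = F (a + 1) b + F a (b + 1) + x * F (a + 1) (b + 1)) :
    F 0 0 = ∑ q ∈ antidiagonal (d + 1), delannoy x q.1 q.2 * F q.1 q.2 +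
      x * ∑ q ∈ antidiagonal d, delannoy x q.1 q.2 * F (q.1 + 1) (q.2 + 1) := by
  induction d with
  | zero =>
    rw [hF 0 0 le_rfl]
    rw [Finset.Nat.sum_antidiagonal_succ]
    simp only [Finset.HasAntidiagonal.antidiagonal_zero, Finset.sum_singleton, delannoy_zero_left,
      delannoy_zero_right, one_mul, zero_add]
    ring
  | succ d ih =>
    have hstep : ∑ q ∈ antidiagonal (d + 1), delannoy x q.1 q.2 * F q.1 q.2 =
        ∑ q ∈ antidiagonal (d + 1), delannoy x q.1 q.2 * F (q.1 + 1) q.2 +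
        ∑ q ∈ antidiagonal (d + 1), delannoy x q.1 q.2 * F q.1 (q.2 + 1) +
        x * ∑ q ∈ antidiagonal (d + 1), delannoy x q.1 q.2 * F (q.1 + 1) (q.2 + 1) := by
      simp only [Finset.mul_sum, ← Finset.sum_add_distrib]
      refine Finset.sum_congr rfl fun q hq => ?_
      rw [hF q.1 q.2 (Finset.HasAntidiagonal.mem_antidiagonal.mp hq).le]
      ring
    have hinner : ∑ q ∈ antidiagonal d,
          delannoy x (q.1 + 1) (q.2 + 1) * F (q.1 + 1) (q.2 + 1) =
        ∑ q ∈ antidiagonal d, delannoy x q.1 (q.2 + 1) * F (q.1 + 1) (q.2 + 1) +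
        ∑ q ∈ antidiagonal d, delannoy x (q.1 + 1) q.2 * F (q.1 + 1) (q.2 + 1) +
        x * ∑ q ∈ antidiagonal d, delannoy x q.1 q.2 * F (q.1 + 1) (q.2 + 1) := by
      simp only [Finset.mul_sum, ← Finset.sum_add_distrib]
      refine Finset.sum_congr rfl fun q _ => ?_
      rw [delannoy_succ_succ]
      ring
    rw [ih fun a b h => hF a b (h.trans d.le_succ), hstep,
      Finset.Nat.sum_antidiagonal_succ' (n := d + 1),
      Finset.Nat.sum_antidiagonal_succ (n := d) (f := fun q => delannoy x q.1 (q.2 + 1) * _),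
      Finset.Nat.sum_antidiagonal_succ' (n := d)
        (f := fun q => delannoy x q.1 q.2 * F (q.1 + 1) q.2),
      Finset.Nat.sum_antidiagonal_succ (n := d)
        (f := fun q => delannoy x q.1 q.2 * F q.1 (q.2 + 1))]
    simp only [hinner, delannoy_zero_left, delannoy_zero_right]
    ring

theorem eval_delannoy (n m : ℕ) : (delannoy Polynomial.X n m).eval x = delannoy x n m := by
  simp [delannoy, Polynomial.eval_finsetSum]

theorem delannoy_mul_delannoy (n m n' m' : ℕ) :
    delannoy x n m * delannoy x n' m' =
      ∑ j ∈ Finset.Icc 0 m, ∑ i ∈ Finset.Icc 0 m',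
        m.choose j * n.choose j * (n'.choose i * m'.choose i) * (1 + x) ^ (i + j) := by
  simp only [delannoy, Finset.sum_mul_sum, Nat.range_succ_eq_Icc_zero]
  exact Finset.sum_congr rfl fun j _ => Finset.sum_congr rfl fun i _ => by ring

end Delannoy

theorem sum_antidiagonal_eq_sum_Icc {M : Type*} [AddCommMonoid M] {c m r N d : ℕ}
    (hd : d + r = c + m) (f : ℕ → ℕ → M)
    (hf : ∀ a b, a + b = d → m < b + r ∨ c + N < a + r → f a b = 0) :
    ∑ q ∈ Finset.HasAntidiagonal.antidiagonal d, f q.1 q.2 =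
      ∑ k ∈ Finset.Icc r (min N m), f (c + k - r) (m - k) := by
  symm
  refine Finset.sum_of_injOn (fun k => (c + k - r, m - k)) ?_ ?_ ?_ fun _ _ => rfl
  · intro k hk l hl hkl
    simp only [Finset.coe_Icc, Set.mem_Icc, Prod.mk.injEq] at hk hl hkl
    omega
  · intro k hk
    simp only [Finset.coe_Icc, Set.mem_Icc, Finset.mem_coe,
      Finset.HasAntidiagonal.mem_antidiagonal] at hk ⊢
    omega
  · rintro ⟨a, b⟩ hab hnot
    rw [Finset.HasAntidiagonal.mem_antidiagonal] at hab
    refine hf a b hab (by_contra fun h => hnot ⟨m - b, ?_, ?_⟩)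
    · simp only [Finset.coe_Icc, Set.mem_Icc]
      omega
    · simp only [Prod.mk.injEq]
      omega

section PartitionSum

variable {α R : Type*} [DecidableEq α] [CommSemiring R]

/-- The partition function of `U` for the weight `w`: the sum over all partitions of `U` of the
product of the weights of the parts. -/
def partitionSum (w : Finset α → R) (U : Finset α) : R :=
  ∑ P : Finpartition U, ∏ τ ∈ P.parts, w τ

variable {w : Finset α → R} {U : Finset α}

@[simp]
theorem partitionSum_empty : partitionSum w ∅ = 1 := by
  exact (Fintype.sum_subsingleton _ (Finpartition.empty (Finset α))).trans Finset.prod_empty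

theorem sum_finpartition_part_eq {v : α} {τ : Finset α} (hτ : τ ⊆ U) (hv : v ∈ τ) :
    ∑ P : Finpartition U with P.part v = τ, ∏ σ ∈ P.parts, w σ =
      w τ * partitionSum w (U \ τ) := by
  have hne : τ ≠ ⊥ := Finset.ne_empty_of_mem hv
  have hnot (Q : Finpartition (U \ τ)) : τ ∉ Q.parts := fun h =>
    (Finset.mem_sdiff.mp (Q.subset h hv)).2 hv
  let ext (Q : Finpartition (U \ τ)) : Finpartition U :=
    Q.extend hne Finset.sdiff_disjoint (Finset.sdiff_union_of_subset hτ)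
  rw [partitionSum, Finset.mul_sum]
  symm
  refine Finset.sum_nbij ext (fun Q _ => ?_) (fun Q _ Q' _ h => ?_) (fun P hP => ?_) fun Q _ => ?_
  · rw [Finset.mem_filter_univ]
    exact Finpartition.part_eq_of_mem _ (Finset.mem_insert_self _ _) hv
  · ext1
    have := congrArg (fun P : Finpartition U => P.parts.erase τ) h
    simpa [ext, Finset.erase_insert (hnot _)] using this
  · rw [Finset.mem_coe, Finset.mem_filter_univ] at hP
    have hmem : τ ∈ P.parts := hP ▸ P.part_mem.mpr (hτ hv)
    have hsup : (P.parts.erase τ).sup id = U \ τ := by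
      ext a
      simp only [Finset.mem_sup, Finset.mem_erase, id, Finset.mem_sdiff]
      constructor
      · rintro ⟨σ, ⟨hσ, hσP⟩, ha⟩
        exact ⟨P.subset hσP ha, fun h => hσ (P.eq_of_mem_parts hσP hmem ha h)⟩
      · rintro ⟨haU, ha⟩
        obtain ⟨σ, hσ, haσ⟩ := P.exists_mem haU
        exact ⟨σ, ⟨fun h => ha (h ▸ haσ), hσ⟩, haσ⟩
    refine ⟨P.ofSubset (Finset.erase_subset τ _) hsup, Finset.mem_coe.mpr (Finset.mem_univ _), ?_⟩
    ext1
    exact Finset.insert_erase hmem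
  · exact (Finset.prod_insert (hnot Q)).symm

theorem partitionSum_eq_sum {v : α} (hv : v ∈ U) (L : Finset (Finset α))
    (hL : ∀ τ ∈ L, v ∈ τ ∧ τ ⊆ U) (hw : ∀ τ ⊆ U, v ∈ τ → w τ ≠ 0 → τ ∈ L) :
    partitionSum w U = ∑ τ ∈ L, w τ * partitionSum w (U \ τ) := by
  have hmaps (P : Finpartition U) (_ : P ∈ Finset.univ) :
      P.part v ∈ U.powerset.filter (v ∈ ·) :=
    Finset.mem_filter.mpr ⟨Finset.mem_powerset.mpr (P.part_subset v), P.mem_part_self.mpr hv⟩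
  have hsub : L ⊆ U.powerset.filter (v ∈ ·) := fun τ hτ =>
    Finset.mem_filter.mpr ⟨Finset.mem_powerset.mpr (hL τ hτ).2, (hL τ hτ).1⟩
  rw [partitionSum, ← Finset.sum_fiberwise_of_maps_to hmaps, Finset.sum_subset hsub]
  · refine Finset.sum_congr rfl fun τ hτ => ?_
    rw [Finset.mem_filter, Finset.mem_powerset] at hτ
    exact sum_finpartition_part_eq hτ.1 hτ.2
  · intro τ hτ hτL
    rw [Finset.mem_filter, Finset.mem_powerset] at hτ
    rw [of_not_not (mt (hw τ hτ.1 hτ.2) hτL), zero_mul]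

theorem partitionSum_eq_mul {v : α} {τ : Finset α} (hτ : τ ⊆ U) (hv : v ∈ τ)
    (hw : ∀ σ ⊆ U, v ∈ σ → w σ ≠ 0 → σ = τ) :
    partitionSum w U = w τ * partitionSum w (U \ τ) := by
  rw [partitionSum_eq_sum (hτ hv) {τ}, Finset.sum_singleton]
  · simpa using ⟨hv, hτ⟩
  · simpa using hw

theorem partitionSum_map {β : Type*} [DecidableEq β] (f : β ↪ α) (V : Finset β) :
    partitionSum (fun τ => w (τ.map f)) V = partitionSum w (V.map f) := by
  induction V using Finset.strongInduction with
  | H V ih =>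
    obtain rfl | ⟨v, hv⟩ := V.eq_empty_or_nonempty
    · simp
    rw [partitionSum_eq_sum hv (V.powerset.filter (v ∈ ·)) (by simp +contextual)
        (by simp +contextual),
      partitionSum_eq_sum (Finset.mem_map_of_mem f hv)
        ((V.powerset.filter (v ∈ ·)).map (Finset.mapEmbedding f).toEmbedding), Finset.sum_map]
    · refine Finset.sum_congr rfl fun τ hτ => ?_
      rw [Finset.mem_filter, Finset.mem_powerset] at hτ
      rw [ih _ (Finset.sdiff_ssubset hτ.1 ⟨v, hτ.2⟩), Finset.map_sdiff]
      rfl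
    · simp only [Finset.mem_map, Finset.mem_filter, Finset.mem_powerset]
      rintro _ ⟨τ, ⟨hτ, hvτ⟩, rfl⟩
      exact ⟨Finset.mem_map_of_mem f hvτ, Finset.map_subset_map.mpr hτ⟩
    · intro σ hσ hvσ _
      obtain ⟨τ, hτ, rfl⟩ := Finset.subset_map_iff.mp hσ
      exact Finset.mem_map_of_mem _ (Finset.mem_filter.mpr
        ⟨Finset.mem_powerset.mpr hτ, (Finset.mem_map' f).mp hvσ⟩)

end PartitionSum

section ClarCover

open Polynomial SimpleGraph

variable {V : Type*} {G H : SimpleGraph V}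

theorem IsDoubleBond.not_isSextet {c : H.ConnectedComponent} (h : IsDoubleBond c) :
    ¬ IsSextet c := fun ⟨g⟩ => by
  obtain ⟨f⟩ := h
  have := Fintype.card_congr (f.symm.trans g).toEquiv
  simp at this

theorem isKekule_iff [Finite V] : IsKekule G H ↔ IsClarCover G H ∧ clarOrder H = 0 := by
  rw [clarOrder, Nat.card_eq_zero, or_iff_left (not_infinite_iff_finite.2 inferInstance),
    isEmpty_subtype]
  constructor
  · rintro ⟨hle, hbond⟩
    exact ⟨⟨hle, fun c => .inl (hbond c)⟩, fun c => (hbond c).not_isSextet⟩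
  · rintro ⟨⟨hle, hcover⟩, hno⟩
    exact ⟨hle, fun c => (hcover c).resolve_right (hno c)⟩

theorem IsClarCover.clarOrder_le_clarNumber [Finite V] (h : IsClarCover G H) :
    clarOrder H ≤ clarNumber G := by
  have hsub : {k | ∃ H, IsClarCover G H ∧ clarOrder H = k} ⊆
      Set.range (clarOrder : SimpleGraph V → ℕ) := by
    rintro k ⟨H, -, rfl⟩
    exact ⟨H, rfl⟩
  exact le_csSup ((Set.finite_range _).subset hsub).bddAbove ⟨H, h, rfl⟩

open Classical in
theorem zzPolynomial_eq_sum [Fintype V] (G : SimpleGraph V) :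
    zzPolynomial G = ∑ H with IsClarCover G H, X ^ clarOrder H := by
  have hmaps (H : SimpleGraph V) (hH : H ∈ ({H | IsClarCover G H} : Finset _)) :
      clarOrder H ∈ Finset.range (clarNumber G + 1) :=
    Finset.mem_range_succ_iff.mpr (Finset.mem_filter_univ H |>.mp hH).clarOrder_le_clarNumber
  rw [zzPolynomial, ← Finset.sum_fiberwise_of_maps_to hmaps]
  refine Finset.sum_congr rfl fun k _ => ?_
  rw [Finset.sum_congr rfl fun H hH => congrArg (X ^ ·) (Finset.mem_filter.mp hH).2,
    Finset.sum_const, Finset.filter_filter, numClarCoversOfOrder, Nat.card_eq_fintype_card,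
    Fintype.card_subtype]
  simp

theorem numKekule_eq_eval_zzPolynomial [Finite V] (G : SimpleGraph V) :
    numKekule G = (zzPolynomial G).eval 0 := by
  rw [zzPolynomial, eval_finsetSum, Finset.sum_range_succ']
  simp [numKekule, numClarCoversOfOrder, isKekule_iff]

theorem numClarCovers_eq_eval_zzPolynomial [Finite V] (G : SimpleGraph V) :
    numClarCovers G = (zzPolynomial G).eval 1 := by
  classical
  have := Fintype.ofFinite V
  rw [zzPolynomial_eq_sum, eval_finsetSum, numClarCovers, Nat.card_eq_fintype_card,
    Fintype.card_subtype]
  simp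

/-- `τ` is the vertex set of a double bond: it induces a complete graph on two vertices. -/
def SpansBond (G : SimpleGraph V) (τ : Finset V) : Prop :=
  Nonempty (G.induce (τ : Set V) ≃g completeGraph (Fin 2))

/-- `τ` is the vertex set of a sextet: it induces a cycle on six vertices. -/
def SpansSextet (G : SimpleGraph V) (τ : Finset V) : Prop :=
  Nonempty (G.induce (τ : Set V) ≃g cycleGraph 6)

open Classical in
/-- The weight of `τ` as a component of a Clar cover: `1` for double bonds, `x` for sextets, and
`0` for the vertex sets that cannot occur. -/
noncomputable def clarWeight {R : Type*} [Semiring R] (G : SimpleGraph V) (x : R)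
    (τ : Finset V) : R :=
  if SpansBond G τ then 1 else if SpansSextet G τ then x else 0

/-- Every six-cycle of `G` is an induced subgraph. -/
def SixCyclesInduced (G : SimpleGraph V) : Prop :=
  ∀ (f : Copy (cycleGraph 6) G) (i j), G.Adj (f i) (f j) → (cycleGraph 6).Adj i j

/-- The spanning subgraph of `G` formed by the edges inside the parts of `P`; it turns a partition
into double bonds and sextets back into a Clar cover. -/
def partitionGraph [Fintype V] [DecidableEq V] (G : SimpleGraph V)
    (P : Finpartition (Finset.univ : Finset V)) : SimpleGraph V where
  Adj u v := G.Adj u v ∧ P.part u = P.part v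
  symm := ⟨fun _ _ ⟨h, hp⟩ => ⟨h.symm, hp.symm⟩⟩
  loopless := ⟨fun _ h => h.1.ne rfl⟩

open Classical in
/-- The partition into the vertex sets of the connected components of `H`. -/
noncomputable def componentPartition [Fintype V] [DecidableEq V] (H : SimpleGraph V) :
    Finpartition (Finset.univ : Finset V) :=
  .ofExistsUnique (Finset.univ.image fun c : H.ConnectedComponent => c.supp.toFinset)
    (fun _ _ => Finset.subset_univ _)
    (fun v _ => ⟨(H.connectedComponentMk v).supp.toFinset, by simp, by
      simp only [Finset.mem_image, Finset.mem_univ, true_and, and_imp, forall_exists_index]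
      rintro _ c rfl hv
      rw [Set.mem_toFinset, ConnectedComponent.mem_supp_iff] at hv
      rw [hv]⟩)
    (by simp [Set.toFinset_eq_empty, ConnectedComponent.nonempty_supp, Set.Nonempty.ne_empty])

open Classical in
theorem componentPartition_parts [Fintype V] [DecidableEq V] (H : SimpleGraph V) :
    (componentPartition H).parts =
      Finset.univ.image fun c : H.ConnectedComponent => c.supp.toFinset :=
  rfl

theorem IsClarCover.induce_supp (hG : SixCyclesInduced G) (h : IsClarCover G H)
    (c : H.ConnectedComponent) : G.induce c.supp = c.toSimpleGraph := by
  refine le_antisymm (fun u v huv => ?_) fun u v huv => h.1 huv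
  obtain ⟨⟨f⟩⟩ | ⟨⟨f⟩⟩ := h.2 c
  · exact f.map_adj_iff.mp (f.injective.ne huv.ne)
  · let g : Copy (cycleGraph 6) G :=
      (Copy.ofLE _ _ h.1).comp ((Embedding.induce c.supp).toCopy.comp f.symm.toCopy)
    refine f.map_adj_iff.mp (hG g _ _ ?_)
    change G.Adj (f.symm (f u)) (f.symm (f v))
    rwa [f.symm_apply_apply, f.symm_apply_apply]

theorem SpansBond.connected {τ : Finset V} (h : SpansBond G τ) :
    (G.induce (τ : Set V)).Connected :=
  h.some.connected_iff.mpr connected_top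

theorem SpansSextet.connected {τ : Finset V} (h : SpansSextet G τ) :
    (G.induce (τ : Set V)).Connected :=
  h.some.connected_iff.mpr cycleGraph_connected

theorem clarWeight_ne_zero {R : Type*} [Semiring R] {x : R} {τ : Finset V}
    (h : clarWeight G x τ ≠ 0) : SpansBond G τ ∨ SpansSextet G τ := by
  contrapose! h
  rw [clarWeight, if_neg h.1, if_neg h.2]

theorem spansBond_supp_iff (hG : SixCyclesInduced G) (h : IsClarCover G H)
    (c : H.ConnectedComponent) [Fintype c.supp] :
    SpansBond G c.supp.toFinset ↔ IsDoubleBond c := by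
  rw [SpansBond, Set.coe_toFinset, h.induce_supp hG]
  rfl

theorem spansSextet_supp_iff (hG : SixCyclesInduced G) (h : IsClarCover G H)
    (c : H.ConnectedComponent) [Fintype c.supp] :
    SpansSextet G c.supp.toFinset ↔ IsSextet c := by
  rw [SpansSextet, Set.coe_toFinset, h.induce_supp hG]
  rfl

open Classical in
theorem clarWeight_supp {R : Type*} [Semiring R] (x : R) (hG : SixCyclesInduced G)
    (h : IsClarCover G H) (c : H.ConnectedComponent) [Fintype c.supp] :
    clarWeight G x c.supp.toFinset = if IsSextet c then x else 1 := by
  rw [clarWeight]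
  obtain hc | hc := h.2 c
  · rw [if_pos ((spansBond_supp_iff hG h c).mpr hc), if_neg hc.not_isSextet]
  · rw [if_neg fun hc' => ((spansBond_supp_iff hG h c).mp hc').not_isSextet hc,
      if_pos ((spansSextet_supp_iff hG h c).mpr hc), if_pos hc]

section Finite

variable [Fintype V] [DecidableEq V] {P : Finpartition (Finset.univ : Finset V)}

theorem partitionGraph_adj {u v : V} :
    (partitionGraph G P).Adj u v ↔ G.Adj u v ∧ P.part u = P.part v :=
  Iff.rfl

theorem supp_partitionGraph (hP : ∀ τ ∈ P.parts, (G.induce (τ : Set V)).Connected) (v : V) :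
    ((partitionGraph G P).connectedComponentMk v).supp = P.part v := by
  ext u
  rw [ConnectedComponent.mem_supp_iff, ConnectedComponent.eq, Finset.mem_coe,
    P.mem_part_iff_part_eq_part (Finset.mem_univ u) (Finset.mem_univ v)]
  constructor
  · rintro ⟨p⟩
    induction p with
    | nil => rfl
    | cons h _ ih => exact h.2.trans ih
  · intro huv
    let f : G.induce (P.part v : Set V) →g partitionGraph G P :=
      { toFun := Subtype.val
        map_rel' := fun {a b} hab => ⟨hab,
          (P.part_eq_of_mem (P.part_mem.mpr (Finset.mem_univ v)) a.2).trans
            (P.part_eq_of_mem (P.part_mem.mpr (Finset.mem_univ v)) b.2).symm⟩ }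
    have hu : u ∈ P.part v := huv ▸ P.mem_part_self.mpr (Finset.mem_univ u)
    have hv : v ∈ P.part v := P.mem_part_self.mpr (Finset.mem_univ v)
    exact ((hP _ (P.part_mem.mpr (Finset.mem_univ v))).preconnected ⟨u, hu⟩ ⟨v, hv⟩).map f

theorem partitionGraph_induce_part (v : V) :
    (partitionGraph G P).induce (P.part v : Set V) = G.induce (P.part v : Set V) := by
  have hpart (a : (P.part v : Set V)) : P.part a = P.part v :=
    P.part_eq_of_mem (P.part_mem.mpr (Finset.mem_univ v)) a.2
  ext a b
  simp [partitionGraph_adj, hpart]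

theorem isClarCover_partitionGraph (hP : ∀ τ ∈ P.parts, SpansBond G τ ∨ SpansSextet G τ) :
    IsClarCover G (partitionGraph G P) := by
  refine ⟨fun u v h => h.1, fun c => ?_⟩
  induction c using ConnectedComponent.ind with
  | h v =>
    have hsupp := supp_partitionGraph
      (fun τ hτ => (hP τ hτ).elim SpansBond.connected SpansSextet.connected) v
    rw [IsDoubleBond, IsSextet]
    change Nonempty ((partitionGraph G P).induce _ ≃g _) ∨
      Nonempty ((partitionGraph G P).induce _ ≃g _)
    rw [hsupp, partitionGraph_induce_part]
    exact hP _ (P.part_mem.mpr (Finset.mem_univ v))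

theorem componentPartition_part (H : SimpleGraph V) (v : V) :
    ((componentPartition H).part v : Set V) = (H.connectedComponentMk v).supp := by
  classical
  rw [(componentPartition H).part_eq_of_mem (t := (H.connectedComponentMk v).supp.toFinset)]
  · simp
  · exact Finset.mem_image_of_mem _ (Finset.mem_univ _)
  · simp

theorem parts_eq_image_part (P : Finpartition (Finset.univ : Finset V)) :
    P.parts = Finset.univ.image P.part := by
  ext τ
  simp only [Finset.mem_image, Finset.mem_univ, true_and]
  constructor
  · intro hτ
    obtain ⟨v, hv⟩ := P.nonempty_of_mem_parts hτ
    exact ⟨v, P.part_eq_of_mem hτ hv⟩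
  · rintro ⟨v, rfl⟩
    exact P.part_mem.mpr (Finset.mem_univ v)

theorem componentPartition_partitionGraph
    (hP : ∀ τ ∈ P.parts, (G.induce (τ : Set V)).Connected) :
    componentPartition (partitionGraph G P) = P := by
  ext1
  have hpart : (componentPartition (partitionGraph G P)).part = P.part := funext fun v =>
    Finset.coe_injective ((componentPartition_part _ v).trans (supp_partitionGraph hP v))
  rw [parts_eq_image_part, parts_eq_image_part, hpart]

theorem partitionGraph_componentPartition (hG : SixCyclesInduced G) (h : IsClarCover G H) :
    partitionGraph G (componentPartition H) = H := by
  ext u v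
  rw [partitionGraph_adj, ← Finset.coe_inj, componentPartition_part, componentPartition_part,
    ConnectedComponent.supp_inj]
  constructor
  · rintro ⟨huv, hc⟩
    have hadj : (G.induce (H.connectedComponentMk u).supp).Adj ⟨u, rfl⟩ ⟨v, hc.symm⟩ := huv
    rwa [h.induce_supp hG] at hadj
  · exact fun huv => ⟨h.1 huv, ConnectedComponent.sound huv.reachable⟩

theorem prod_clarWeight_componentPartition {R : Type*} [CommSemiring R] (x : R)
    (hG : SixCyclesInduced G) (h : IsClarCover G H) :
    ∏ τ ∈ (componentPartition H).parts, clarWeight G x τ = x ^ clarOrder H := by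
  classical
  calc ∏ τ ∈ (componentPartition H).parts, clarWeight G x τ
      = ∏ c : H.ConnectedComponent, clarWeight G x c.supp.toFinset :=
        Finset.prod_image fun c _ c' _ hcc' =>
          ConnectedComponent.supp_inj.mp (Set.toFinset_inj.mp hcc')
    _ = ∏ c : H.ConnectedComponent, if IsSextet c then x else 1 :=
        Finset.prod_congr rfl fun c _ => clarWeight_supp x hG h c
    _ = x ^ clarOrder H := by
        rw [← Finset.prod_filter, Finset.prod_const, clarOrder, Nat.card_eq_fintype_card,
          Fintype.card_subtype]

open Classical in
theorem sum_isClarCover_eq_partitionSum {R : Type*} [CommSemiring R] (x : R)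
    (hG : SixCyclesInduced G) :
    ∑ H with IsClarCover G H, x ^ clarOrder H = partitionSum (clarWeight G x) Finset.univ := by
  let tiled : Finset (Finpartition (Finset.univ : Finset V)) :=
    {P | ∀ τ ∈ P.parts, SpansBond G τ ∨ SpansSextet G τ}
  have hconn {P} (hP : P ∈ tiled) (τ) (hτ : τ ∈ P.parts) : (G.induce (τ : Set V)).Connected :=
    ((Finset.mem_filter_univ P).mp hP τ hτ).elim SpansBond.connected SpansSextet.connected
  have hzero (P : Finpartition (Finset.univ : Finset V)) (_ : P ∈ Finset.univ) (hP : P ∉ tiled) :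
      ∏ τ ∈ P.parts, clarWeight G x τ = 0 := by
    by_contra hne
    exact hP ((Finset.mem_filter_univ P).mpr fun τ hτ =>
      clarWeight_ne_zero fun h0 => hne (Finset.prod_eq_zero hτ h0))
  rw [partitionSum, ← Finset.sum_subset (Finset.subset_univ tiled) hzero]
  refine Finset.sum_bij' (fun H _ => componentPartition H) (fun P _ => partitionGraph G P)
    (fun H hH => ?_) (fun P hP => ?_) (fun H hH => ?_) (fun P hP => ?_) fun H hH => ?_
  · rw [Finset.mem_filter_univ] at hH
    rw [Finset.mem_filter_univ, componentPartition_parts, Finset.forall_mem_image]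
    exact fun c _ => (hH.2 c).imp (spansBond_supp_iff hG hH c).mpr
      (spansSextet_supp_iff hG hH c).mpr
  · exact (Finset.mem_filter_univ _).mpr
      (isClarCover_partitionGraph ((Finset.mem_filter_univ P).mp hP))
  · exact partitionGraph_componentPartition hG ((Finset.mem_filter_univ H).mp hH)
  · exact componentPartition_partitionGraph (hconn hP)
  · exact (prod_clarWeight_componentPartition x hG ((Finset.mem_filter_univ H).mp hH)).symm

end Finite

end ClarCover

section Embedding

open Polynomial SimpleGraph

variable {V W : Type*} {G : SimpleGraph V} {K : SimpleGraph W}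

theorem nonempty_induce_iso_induce_map (f : G ↪g K) (τ : Finset V) :
    Nonempty (G.induce (τ : Set V) ≃g K.induce (τ.map f.toEmbedding : Set W)) := by
  have hrange : Set.range (f.comp (Embedding.induce (τ : Set V))) =
      (τ.map f.toEmbedding : Set W) := by
    ext w
    simp
  exact ⟨hrange ▸ (f.comp (Embedding.induce (τ : Set V))).isoInduceRange⟩

theorem clarWeight_map {R : Type*} [Semiring R] (x : R) (f : G ↪g K) (τ : Finset V) :
    clarWeight K x (τ.map f.toEmbedding) = clarWeight G x τ := by
  obtain ⟨g⟩ := nonempty_induce_iso_induce_map f τ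
  have hbond : SpansBond K (τ.map f.toEmbedding) ↔ SpansBond G τ :=
    ⟨fun ⟨e⟩ => ⟨g.trans e⟩, fun ⟨e⟩ => ⟨g.symm.trans e⟩⟩
  have hsextet : SpansSextet K (τ.map f.toEmbedding) ↔ SpansSextet G τ :=
    ⟨fun ⟨e⟩ => ⟨g.trans e⟩, fun ⟨e⟩ => ⟨g.symm.trans e⟩⟩
  classical
  exact if_congr hbond rfl (if_congr hsextet rfl rfl)

theorem SixCyclesInduced.of_embedding (hK : SixCyclesInduced K) (f : G ↪g K) :
    SixCyclesInduced G := fun c i j hij =>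
  hK (f.toCopy.comp c) i j (f.map_adj_iff.mpr hij)

theorem zzPolynomial_eq_partitionSum [Fintype V] [DecidableEq W] (f : G ↪g K)
    (hK : SixCyclesInduced K) :
    zzPolynomial G = partitionSum (clarWeight K X) (Finset.univ.map f.toEmbedding) := by
  classical
  rw [zzPolynomial_eq_sum, sum_isClarCover_eq_partitionSum X (hK.of_embedding f),
    ← partitionSum_map]
  simp only [clarWeight_map]

end Embedding

section Honeycomb

open SimpleGraph

@[simp]
theorem honeycomb_adj_A_B {a b c d : ℕ} :
    honeycomb.Adj (.A a b) (.B c d) ↔ a ≤ c ∧ b ≤ d ∧ c + d ≤ a + b + 1 := by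
  simp only [honeycomb, fromRel_adj, HexVertex.A.injEq, HexVertex.B.injEq, reduceCtorEq]
  constructor
  · rintro ⟨-, ⟨_, _, h, h'⟩ | ⟨_, _, h, -⟩⟩
    · omega
    · exact h.elim
  · exact fun h => ⟨by simp, .inl ⟨a, b, ⟨rfl, rfl⟩, by omega⟩⟩

@[simp]
theorem honeycomb_adj_B_A {a b c d : ℕ} :
    honeycomb.Adj (.B c d) (.A a b) ↔ a ≤ c ∧ b ≤ d ∧ c + d ≤ a + b + 1 := by
  rw [adj_comm, honeycomb_adj_A_B]

@[simp]
theorem not_honeycomb_adj_A_A {a b c d : ℕ} : ¬ honeycomb.Adj (.A a b) (.A c d) := by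
  simp [honeycomb]

@[simp]
theorem not_honeycomb_adj_B_B {a b c d : ℕ} : ¬ honeycomb.Adj (.B a b) (.B c d) := by
  simp [honeycomb]

@[simp]
theorem A_mem_hexagon {a b : ℕ} {h : ℕ × ℕ} :
    .A a b ∈ hexagon h ↔ h.1 ≤ a ∧ h.2 ≤ b ∧ a + b ≤ h.1 + h.2 + 1 := by
  simp only [hexagon, Finset.mem_insert, Finset.mem_singleton, HexVertex.A.injEq, reduceCtorEq,
    false_or, or_false]
  omega

@[simp]
theorem B_mem_hexagon {a b : ℕ} {h : ℕ × ℕ} :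
    .B a b ∈ hexagon h ↔ a ≤ h.1 + 1 ∧ b ≤ h.2 + 1 ∧ h.1 + h.2 + 1 ≤ a + b := by
  simp only [hexagon, Finset.mem_insert, Finset.mem_singleton, HexVertex.B.injEq, reduceCtorEq,
    false_or]
  omega

theorem eq_of_honeycomb_adj {u w p q : HexVertex} (huw : u ≠ w) (hup : honeycomb.Adj u p)
    (hwp : honeycomb.Adj w p) (huq : honeycomb.Adj u q) (hwq : honeycomb.Adj w q) : p = q := by
  rcases u with ⟨a, b⟩ | ⟨a, b⟩ <;> rcases w with ⟨a', b'⟩ | ⟨a', b'⟩ <;>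
    rcases p with ⟨c, d⟩ | ⟨c, d⟩ <;> rcases q with ⟨c', d'⟩ | ⟨c', d'⟩ <;>
    simp at * <;> omega

theorem exists_eq_B_of_honeycomb_adj {a b : ℕ} {v : HexVertex} (h : honeycomb.Adj (.A a b) v) :
    ∃ c d, v = .B c d := by
  rcases v with ⟨c, d⟩ | ⟨c, d⟩
  · exact absurd h not_honeycomb_adj_A_A
  · exact ⟨c, d, rfl⟩

theorem exists_eq_A_of_honeycomb_adj {a b : ℕ} {v : HexVertex} (h : honeycomb.Adj (.B a b) v) :
    ∃ c d, v = .A c d := by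
  rcases v with ⟨c, d⟩ | ⟨c, d⟩
  · exact ⟨c, d, rfl⟩
  · exact absurd h not_honeycomb_adj_B_B

theorem exists_forall_eq_or_eq_add_one {x y z : ℕ} (hxy : x ≤ y + 1) (hyx : y ≤ x + 1)
    (hyz : y ≤ z + 1) (hzy : z ≤ y + 1) (hxz : x ≤ z + 1) (hzx : z ≤ x + 1) :
    ∃ s, (x = s ∨ x = s + 1) ∧ (y = s ∨ y = s + 1) ∧ (z = s ∨ z = s + 1) :=
  ⟨min x (min y z), by omega⟩

/-- Three pairwise distinct vertices `A`, any two with a common neighbour, are three corners of a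
lattice square `{a, a + 1} × {b, b + 1}`. If the corner `(a, b)` is missing, then the common
neighbours all coincide; so `(a + 1, b + 1)` is missing, which leaves the hexagon `(a, b)`. -/
theorem exists_hexagon_of_alternating_sixCycle {a₀ b₀ c₁ d₁ a₂ b₂ c₃ d₃ a₄ b₄ c₅ d₅ : ℕ}
    (h₀ : honeycomb.Adj (.A a₀ b₀) (.B c₁ d₁)) (h₁ : honeycomb.Adj (.A a₂ b₂) (.B c₁ d₁))
    (h₂ : honeycomb.Adj (.A a₂ b₂) (.B c₃ d₃)) (h₃ : honeycomb.Adj (.A a₄ b₄) (.B c₃ d₃))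
    (h₄ : honeycomb.Adj (.A a₄ b₄) (.B c₅ d₅)) (h₅ : honeycomb.Adj (.A a₀ b₀) (.B c₅ d₅))
    (h₀₂ : HexVertex.A a₀ b₀ ≠ .A a₂ b₂) (h₂₄ : HexVertex.A a₂ b₂ ≠ .A a₄ b₄)
    (h₀₄ : HexVertex.A a₀ b₀ ≠ .A a₄ b₄) (h₁₃ : HexVertex.B c₁ d₁ ≠ .B c₃ d₃) :
    ∃ h, .A a₀ b₀ ∈ hexagon h ∧ .B c₁ d₁ ∈ hexagon h ∧ .A a₂ b₂ ∈ hexagon h ∧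
      .B c₃ d₃ ∈ hexagon h ∧ .A a₄ b₄ ∈ hexagon h ∧ .B c₅ d₅ ∈ hexagon h := by
  simp only [honeycomb_adj_A_B, A_mem_hexagon, B_mem_hexagon, ne_eq, HexVertex.A.injEq,
    HexVertex.B.injEq] at *
  obtain ⟨a, ha⟩ : ∃ a, (a₀ = a ∨ a₀ = a + 1) ∧ (a₂ = a ∨ a₂ = a + 1) ∧ (a₄ = a ∨ a₄ = a + 1) := by
    apply exists_forall_eq_or_eq_add_one <;> omega
  obtain ⟨b, hb⟩ : ∃ b, (b₀ = b ∨ b₀ = b + 1) ∧ (b₂ = b ∨ b₂ = b + 1) ∧ (b₄ = b ∨ b₄ = b + 1) := by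
    apply exists_forall_eq_or_eq_add_one <;> omega
  refine ⟨(a, b), ?_⟩
  obtain ⟨rfl | rfl, rfl | rfl, rfl | rfl⟩ := ha <;>
    obtain ⟨rfl | rfl, rfl | rfl, rfl | rfl⟩ := hb <;>
    first | (exfalso; omega) | (and_intros <;> omega)

theorem exists_hexagon_of_sixCycle (v : Fin 6 → HexVertex) (hv : Function.Injective v)
    (hadj : ∀ i, honeycomb.Adj (v i) (v (i + 1))) : ∃ h, ∀ i, v i ∈ hexagon h := by
  wlog hA : ∃ a b, v 0 = .A a b generalizing v
  · obtain ⟨a, b, h0⟩ : ∃ a b, v 0 = .B a b := by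
      rcases hv0 : v 0 with ⟨a, b⟩ | ⟨a, b⟩
      exacts [(hA ⟨a, b, hv0⟩).elim, ⟨a, b, rfl⟩]
    obtain ⟨h, hh⟩ := this (fun i => v (i + 1)) (hv.comp (add_left_injective 1))
      (fun i => hadj (i + 1)) (exists_eq_A_of_honeycomb_adj (h0 ▸ hadj 0))
    exact ⟨h, fun i => by simpa using hh (i - 1)⟩
  obtain ⟨a₀, b₀, h0⟩ := hA
  obtain ⟨c₁, d₁, h1⟩ : ∃ c d, v 1 = .B c d := exists_eq_B_of_honeycomb_adj (h0 ▸ hadj 0)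
  obtain ⟨a₂, b₂, h2⟩ : ∃ a b, v 2 = .A a b := exists_eq_A_of_honeycomb_adj (h1 ▸ hadj 1)
  obtain ⟨c₃, d₃, h3⟩ : ∃ c d, v 3 = .B c d := exists_eq_B_of_honeycomb_adj (h2 ▸ hadj 2)
  obtain ⟨a₄, b₄, h4⟩ : ∃ a b, v 4 = .A a b := exists_eq_A_of_honeycomb_adj (h3 ▸ hadj 3)
  obtain ⟨c₅, d₅, h5⟩ : ∃ c d, v 5 = .B c d := exists_eq_B_of_honeycomb_adj (h4 ▸ hadj 4)
  have hne {i j : Fin 6} (hij : i ≠ j) : v i ≠ v j := hv.ne hij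
  obtain ⟨h, hh⟩ := exists_hexagon_of_alternating_sixCycle
    (h0 ▸ h1 ▸ hadj 0) (h1 ▸ h2 ▸ (hadj 1).symm) (h2 ▸ h3 ▸ hadj 2) (h3 ▸ h4 ▸ (hadj 3).symm)
    (h4 ▸ h5 ▸ hadj 4) (h5 ▸ h0 ▸ (hadj 5).symm) (h0 ▸ h2 ▸ hne (by decide))
    (h2 ▸ h4 ▸ hne (by decide)) (h0 ▸ h4 ▸ hne (by decide)) (h1 ▸ h3 ▸ hne (by decide))
  exact ⟨h, by simpa [Fin.forall_fin_succ, h0, h1, h2, h3, h4, h5] using hh⟩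

theorem not_honeycomb_adj_of_adj_of_adj {u v w : HexVertex} (huv : honeycomb.Adj u v)
    (hvw : honeycomb.Adj v w) : ¬ honeycomb.Adj u w := by
  rcases u with _ | _ <;> rcases v with _ | _ <;> rcases w with _ | _ <;> simp_all

theorem sixCyclesInduced_honeycomb : SixCyclesInduced honeycomb := by
  intro f i j hij
  have hadj (k : Fin 6) : honeycomb.Adj (f k) (f (k + 1)) :=
    f.toHom.map_adj (cycleGraph_adj.mpr (.inr (add_sub_cancel_left k 1)))
  have hcases : ∀ i j : Fin 6, j = i ∨ j = i + 1 ∨ i = j + 1 ∨ j = i + 1 + 1 ∨ i = j + 1 + 1 ∨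
      j = i + 1 + 1 + 1 := by
    decide
  rw [cycleGraph_adj]
  obtain rfl | rfl | rfl | rfl | rfl | rfl := hcases i j
  · exact (hij.ne rfl).elim
  · exact .inr (add_sub_cancel_left i 1)
  · exact .inl (add_sub_cancel_left j 1)
  · exact (not_honeycomb_adj_of_adj_of_adj (hadj i) (hadj _) hij).elim
  · exact (not_honeycomb_adj_of_adj_of_adj (hadj j) (hadj _) hij.symm).elim
  · have hne (k : Fin 6) : f k ≠ f (k + 1 + 1) := f.injective.ne (by simp [add_assoc])
    exact (hne (i + 1) (eq_of_honeycomb_adj (hne i) (hadj i) (hadj _).symm hij (hadj _))).elim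

theorem spansBond_iff {V : Type*} [DecidableEq V] {G : SimpleGraph V} {τ : Finset V} :
    SpansBond G τ ↔ ∃ u v, G.Adj u v ∧ τ = {u, v} := by
  constructor
  · rintro ⟨f⟩
    refine ⟨f.symm 0, f.symm 1, f.symm.map_adj_iff.mpr (by simp), ?_⟩
    ext w
    rw [Finset.mem_insert, Finset.mem_singleton]
    constructor
    · intro hw
      have : f ⟨w, hw⟩ = 0 ∨ f ⟨w, hw⟩ = 1 := by omega
      exact this.imp (fun h => by rw [← h, f.symm_apply_apply])
        fun h => by rw [← h, f.symm_apply_apply]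
    · rintro (rfl | rfl)
      exacts [(f.symm 0).2, (f.symm 1).2]
  · rintro ⟨u, v, huv, rfl⟩
    have htop : G.induce (({u, v} : Finset V) : Set V) = ⊤ := by
      rw [induce_eq_top, Finset.coe_pair, isClique_pair]
      exact fun _ => huv
    have hcard : Nat.card (({u, v} : Finset V) : Set V) = 2 := by
      rw [Nat.card_coe_set_eq, Set.ncard_coe_finset, Finset.card_pair huv.ne]
    rw [SpansBond, htop]
    exact ⟨Iso.completeGraph (Finite.equivFinOfCardEq hcard)⟩

theorem card_hexagon (h : ℕ × ℕ) : (hexagon h).card = 6 := by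
  simp [hexagon]

theorem pair_ne_hexagon {u v : HexVertex} {h : ℕ × ℕ} : {u, v} ≠ hexagon h := fun huv => by
  have := (congrArg Finset.card huv).trans (card_hexagon h)
  have := Finset.card_le_two (a := u) (b := v)
  omega

theorem spansSextet_honeycomb_iff {τ : Finset HexVertex} :
    SpansSextet honeycomb τ ↔ ∃ h, τ = hexagon h := by
  constructor
  · rintro ⟨f⟩
    obtain ⟨h, hh⟩ := exists_hexagon_of_sixCycle (fun i => f.symm i)
      (Subtype.val_injective.comp f.symm.injective)
      fun i => f.symm.map_adj_iff.mpr (cycleGraph_adj.mpr (.inr (add_sub_cancel_left i 1)))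
    refine ⟨h, Finset.eq_of_subset_of_card_le (fun v hv => ?_) ?_⟩
    · simpa using hh (f ⟨v, hv⟩)
    · rw [card_hexagon]
      simpa using (Nat.card_congr f.toEquiv).ge
  · rintro ⟨⟨a, b⟩, rfl⟩
    let v : Fin 6 → HexVertex := ![.A a b, .B a (b + 1), .A a (b + 1), .B (a + 1) (b + 1),
      .A (a + 1) b, .B (a + 1) b]
    have hv (i : Fin 6) : v i ∈ hexagon (a, b) := by
      fin_cases i <;> simp [v, hexagon]
    have hadj (i : Fin 6) : honeycomb.Adj (v i) (v (i + 1)) := by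
      fin_cases i
      exacts [honeycomb_adj_A_B.mpr (by omega), honeycomb_adj_B_A.mpr (by omega),
        honeycomb_adj_A_B.mpr (by omega), honeycomb_adj_B_A.mpr (by omega),
        honeycomb_adj_A_B.mpr (by omega), honeycomb_adj_B_A.mpr (by omega)]
    have hinj : Function.Injective v := by
      intro i j hij
      fin_cases i <;> fin_cases j <;> simp [v] at hij ⊢
    let f : Copy (cycleGraph 6) honeycomb := ⟨⟨v, fun {i j} hij => by
      obtain h | h := cycleGraph_adj.mp hij
      · rw [sub_eq_iff_eq_add'.mp h]
        exact (hadj j).symm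
      · rw [sub_eq_iff_eq_add'.mp h]
        exact hadj i⟩, hinj⟩
    let g : Fin 6 → (hexagon (a, b) : Set HexVertex) := fun i => ⟨v i, hv i⟩
    have hg : Function.Bijective g := by
      rw [Fintype.bijective_iff_injective_and_card]
      exact ⟨fun i j hij => hinj (congrArg Subtype.val hij), by simp [card_hexagon]⟩
    exact ⟨Iso.symm ⟨Equiv.ofBijective g hg, fun {i j} =>
      ⟨sixCyclesInduced_honeycomb f i j, f.toHom.map_adj⟩⟩⟩

theorem clarWeight_honeycomb_edge {R : Type*} [Semiring R] (x : R) {u v : HexVertex}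
    (h : honeycomb.Adj u v) : clarWeight honeycomb x {u, v} = 1 :=
  if_pos (spansBond_iff.mpr ⟨u, v, h, rfl⟩)

theorem clarWeight_honeycomb_hexagon {R : Type*} [Semiring R] (x : R) (h : ℕ × ℕ) :
    clarWeight honeycomb x (hexagon h) = x := by
  rw [clarWeight, if_neg, if_pos (spansSextet_honeycomb_iff.mpr ⟨h, rfl⟩)]
  rw [spansBond_iff]
  rintro ⟨u, v, -, heq⟩
  exact pair_ne_hexagon heq.symm

theorem edge_or_hexagon_of_clarWeight_ne_zero {R : Type*} [Semiring R] {x : R}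
    {τ : Finset HexVertex} (h : clarWeight honeycomb x τ ≠ 0) :
    (∃ u v, honeycomb.Adj u v ∧ τ = {u, v}) ∨ ∃ h, τ = hexagon h :=
  (clarWeight_ne_zero h).imp spansBond_iff.mp spansSextet_honeycomb_iff.mp

end Honeycomb

section Region

/-- The position of the vertical edge through a vertex: its end points `A a b` and `B a b` share the
position `(a, b)`. -/
def position : HexVertex → ℕ × ℕ
  | .A a b => (a, b)
  | .B a b => (a, b)

@[simp]
theorem position_A (a b : ℕ) : position (.A a b) = (a, b) :=
  rfl

@[simp]
theorem position_B (a b : ℕ) : position (.B a b) = (a, b) :=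
  rfl

/-- The vertices at the positions in `P`, except for the upper end `B` at the source `s` and the
lower end `A` at the sink `t`. -/
def region (P : Finset (ℕ × ℕ)) (s t : ℕ × ℕ) : Finset HexVertex :=
  (P.erase t).image (fun q => .A q.1 q.2) ∪ (P.erase s).image fun q => .B q.1 q.2

@[simp]
theorem A_mem_region {P : Finset (ℕ × ℕ)} {s t : ℕ × ℕ} {a b : ℕ} :
    .A a b ∈ region P s t ↔ (a, b) ∈ P ∧ (a, b) ≠ t := by
  simp [region, and_comm]

@[simp]
theorem B_mem_region {P : Finset (ℕ × ℕ)} {s t : ℕ × ℕ} {a b : ℕ} :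
    .B a b ∈ region P s t ↔ (a, b) ∈ P ∧ (a, b) ≠ s := by
  simp [region, and_comm]

variable {R : Type*} [CommSemiring R] (x : R)

/-- The topmost vertex `B` in `L` is forced into the double bond with the `A` below it. -/
theorem eq_vertical_edge_of_clarWeight_ne_zero {U : Finset HexVertex} {L : Set (ℕ × ℕ)}
    (hL : IsLowerSet L) (hU : ∀ a b, (a, b) ∈ L → (.A a b ∈ U ↔ .B a b ∈ U)) {a b : ℕ}
    (hab : Minimal (fun q => q ∈ L ∧ .B q.1 q.2 ∈ U) (a, b)) {τ : Finset HexVertex} (hτU : τ ⊆ U)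
    (hBτ : .B a b ∈ τ) (hτ : clarWeight honeycomb x τ ≠ 0) : τ = {.A a b, .B a b} := by
  have hmin {c d : ℕ} (hA : .A c d ∈ τ) (hca : c ≤ a) (hdb : d ≤ b) : c = a ∧ d = b := by
    have hcd : (c, d) ∈ L := hL (Prod.mk_le_mk.mpr ⟨hca, hdb⟩) hab.prop.1
    exact Prod.mk.inj (hab.eq_of_le ⟨hcd, (hU c d hcd).mp (hτU hA)⟩ (Prod.mk_le_mk.mpr ⟨hca, hdb⟩))
  obtain ⟨u, v, huv, rfl⟩ | ⟨⟨c, d⟩, rfl⟩ := edge_or_hexagon_of_clarWeight_ne_zero hτ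
  · rcases u with ⟨c, d⟩ | ⟨c, d⟩ <;> rcases v with ⟨e, f⟩ | ⟨e, f⟩ <;>
      simp only [not_honeycomb_adj_A_A, not_honeycomb_adj_B_B, honeycomb_adj_A_B,
        honeycomb_adj_B_A, Finset.mem_insert, Finset.mem_singleton, HexVertex.B.injEq, reduceCtorEq,
        false_or, or_false] at huv hBτ
    · obtain ⟨rfl, rfl⟩ := hBτ
      obtain ⟨rfl, rfl⟩ := hmin (c := c) (d := d) (by simp) huv.1 huv.2.1
      rfl
    · obtain ⟨rfl, rfl⟩ := hBτ
      obtain ⟨rfl, rfl⟩ := hmin (c := e) (d := f) (by simp) huv.1 huv.2.1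
      exact Finset.pair_comm _ _
  · rw [B_mem_hexagon] at hBτ
    have h := hmin (c := c) (d := d) (by simp) (by omega) (by omega)
    omega

theorem partitionSum_eq_filter_position_notMem {U : Finset HexVertex} {L : Set (ℕ × ℕ)}
    [DecidablePred (· ∈ L)] (hL : IsLowerSet L)
    (hU : ∀ a b, (a, b) ∈ L → (.A a b ∈ U ↔ .B a b ∈ U)) :
    partitionSum (clarWeight honeycomb x) U =
      partitionSum (clarWeight honeycomb x) {v ∈ U | position v ∉ L} := by
  induction U using Finset.strongInduction with
  | H U ih =>
    by_cases hex : ∃ q, q ∈ L ∧ .B q.1 q.2 ∈ U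
    · obtain ⟨⟨a, b⟩, hab⟩ := exists_minimal_of_wellFoundedLT _ hex
      obtain ⟨habL, hB⟩ := hab.prop
      have hA : .A a b ∈ U := (hU a b habL).mpr hB
      have hsub : {.A a b, .B a b} ⊆ U := by simp [Finset.insert_subset_iff, hA, hB]
      rw [partitionSum_eq_mul hsub (v := .B a b) (by simp) fun τ hτU hBτ hτ =>
          eq_vertical_edge_of_clarWeight_ne_zero x hL hU hab hτU hBτ hτ,
        clarWeight_honeycomb_edge x (by simp), one_mul,
        ih _ (Finset.sdiff_ssubset hsub (by simp)) fun c d hcd => by simp [hU c d hcd]]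
      congr 1
      ext (⟨c, d⟩ | ⟨c, d⟩) <;>
        simp only [Finset.mem_filter, Finset.mem_sdiff, Finset.mem_insert, Finset.mem_singleton,
          HexVertex.A.injEq, HexVertex.B.injEq, reduceCtorEq, position_A, position_B] <;>
        grind
    · push Not at hex
      rw [Finset.filter_true_of_mem]
      rintro (⟨c, d⟩ | ⟨c, d⟩) hv hL
      · exact hex _ hL ((hU c d hL).mp hv)
      · exact hex _ hL hv

/-- The weighted number of ways to complete a Clar cover of the region of `P` with sink `t` once
its path has reached `q`, and `0` if `q` is not a position in `P`. -/
noncomputable def tailSum (P : Finset (ℕ × ℕ)) (t q : ℕ × ℕ) : R :=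
  if q ∈ P then partitionSum (clarWeight honeycomb x) (region {p ∈ P | q ≤ p} q t) else 0

variable {P : Finset (ℕ × ℕ)} {t : ℕ × ℕ}

theorem tailSum_of_notMem {q : ℕ × ℕ} (hq : q ∉ P) : tailSum x P t q = 0 :=
  if_neg hq

theorem tailSum_sink (ht : t ∈ P) (hP : ∀ p ∈ P, p ≤ t) : tailSum x P t t = 1 := by
  have hempty : region {p ∈ P | t ≤ p} t t = ∅ := by
    ext (⟨a, b⟩ | ⟨a, b⟩) <;>
      simpa using fun h h' => (hP _ h).antisymm h'
  rw [tailSum, if_pos ht, hempty, partitionSum_empty]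

theorem partitionSum_region_sdiff (hP : ∀ p ∈ P, p ≤ t) {s c : ℕ × ℕ} (hsc : s < c) (hc : c ∈ P)
    {τ : Finset HexVertex} (hs : .A s.1 s.2 ∈ τ)
    (hτ : ∀ a b, (a, b) ≠ s → ¬ c ≤ (a, b) → (.A a b ∈ τ ↔ .B a b ∈ τ))
    (hτc : ∀ a b, c ≤ (a, b) → .A a b ∉ τ ∧ (.B a b ∈ τ ↔ (a, b) = c)) :
    partitionSum (clarWeight honeycomb x) (region {p ∈ P | s ≤ p} s t \ τ) = tailSum x P t c := by
  classical
  rw [tailSum, if_pos hc, partitionSum_eq_filter_position_notMem x (isUpperSet_Ici c).compl]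
  · have hs' {q : ℕ × ℕ} (hq : c ≤ q) : q ≠ s ∧ s ≤ q :=
      ⟨(hsc.trans_le hq).ne', hsc.le.trans hq⟩
    congr 1
    ext (⟨a, b⟩ | ⟨a, b⟩) <;>
      simp only [Set.mem_compl_iff, Set.mem_Ici, Finset.mem_filter, Finset.mem_sdiff, A_mem_region,
        B_mem_region, position_A, position_B] <;>
      grind
  · intro a b hab
    have hne : (a, b) ≠ t := fun h => hab ((hP c hc).trans_eq h.symm)
    simp only [Finset.mem_sdiff, Finset.mem_filter, A_mem_region, B_mem_region]
    grind

variable {a b : ℕ}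

theorem partitionSum_region_sdiff_edge (hP : ∀ p ∈ P, p ≤ t) {c d : ℕ} (hc : (c, d) ∈ P)
    (hlt : (a, b) < (c, d)) :
    partitionSum (clarWeight honeycomb x)
      (region {p ∈ P | (a, b) ≤ p} (a, b) t \ {.A a b, .B c d}) = tailSum x P t (c, d) := by
  apply partitionSum_region_sdiff x hP hlt hc (by simp)
  · intro e f hne hle
    have : (e, f) ≠ (c, d) := fun h => hle h.ge
    simpa using by grind
  · intro e f hle
    have : (e, f) ≠ (a, b) := (hlt.trans_le hle).ne'
    simpa using by grind

theorem partitionSum_region_sdiff_hexagon (hP : ∀ p ∈ P, p ≤ t) (hc : (a + 1, b + 1) ∈ P) :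
    partitionSum (clarWeight honeycomb x)
      (region {p ∈ P | (a, b) ≤ p} (a, b) t \ hexagon (a, b)) = tailSum x P t (a + 1, b + 1) := by
  apply partitionSum_region_sdiff x hP (by simp [Prod.lt_iff]) hc (by simp)
  · intro e f hne hle
    rw [ne_eq, Prod.mk.injEq] at hne
    rw [Prod.mk_le_mk] at hle
    rw [A_mem_hexagon, B_mem_hexagon]
    omega
  · intro e f hle
    rw [Prod.mk_le_mk] at hle
    rw [A_mem_hexagon, B_mem_hexagon, Prod.mk.injEq]
    omega

theorem edge_subset_region_iff (hab : (a, b) ∈ P) (ht : (a, b) ≠ t) {c d : ℕ}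
    (hcd : (a, b) < (c, d)) :
    {.A a b, .B c d} ⊆ region {p ∈ P | (a, b) ≤ p} (a, b) t ↔ (c, d) ∈ P := by
  simp only [Finset.insert_subset_iff, Finset.singleton_subset_iff, A_mem_region, B_mem_region,
    Finset.mem_filter]
  exact ⟨fun h => h.2.1.1, fun h => ⟨⟨⟨hab, le_rfl⟩, ht⟩, ⟨h, hcd.le⟩, hcd.ne'⟩⟩

theorem hexagon_subset_region_iff (hP : ∀ p ∈ P, p ≤ t) (hab : (a, b) ∈ P) :
    hexagon (a, b) ⊆ region {p ∈ P | (a, b) ≤ p} (a, b) t ↔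
      (a + 1, b) ∈ P ∧ (a, b + 1) ∈ P ∧ (a + 1, b + 1) ∈ P := by
  simp only [hexagon, Finset.insert_subset_iff, Finset.singleton_subset_iff, A_mem_region,
    B_mem_region, Finset.mem_filter, Prod.mk_le_mk]
  constructor
  · rintro ⟨-, h₁, -, h₂, h₃, -⟩
    exact ⟨h₃.1.1, h₁.1.1, h₂.1.1⟩
  · rintro ⟨h₁, h₂, h₃⟩
    have ht {q : ℕ × ℕ} (hq : q < (a + 1, b + 1)) : q ≠ t := (hq.trans_le (hP _ h₃)).ne
    simp [hab, h₁, h₂, h₃, ht, Prod.lt_iff]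

theorem edge_or_hexagon_of_source_mem {τ : Finset HexVertex} (hτ : τ ⊆ region P (a, b) t)
    (hA : .A a b ∈ τ) (hw : clarWeight honeycomb x τ ≠ 0) :
    τ = {.A a b, .B (a + 1) b} ∨ τ = {.A a b, .B a (b + 1)} ∨ τ = hexagon (a, b) := by
  have hB : .B a b ∉ τ := fun h => by simpa using hτ h
  obtain ⟨u, v, huv, rfl⟩ | ⟨⟨c, d⟩, rfl⟩ := edge_or_hexagon_of_clarWeight_ne_zero hw
  · wlog huA : u = .A a b generalizing u v
    · rw [Finset.pair_comm] at hτ hA hB hw ⊢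
      refine this v u huv.symm hτ hA hw hB ?_
      rw [Finset.mem_insert, Finset.mem_singleton] at hA
      exact (hA.resolve_right (Ne.symm huA)).symm
    · subst huA
      obtain ⟨c, d, rfl⟩ := exists_eq_B_of_honeycomb_adj huv
      simp only [honeycomb_adj_A_B, Finset.mem_insert, Finset.mem_singleton, HexVertex.B.injEq,
        reduceCtorEq, false_or] at huv hB
      obtain ⟨rfl, rfl⟩ | ⟨rfl, rfl⟩ : (c = a + 1 ∧ d = b) ∨ (c = a ∧ d = b + 1) := by omega
      exacts [.inl rfl, .inr (.inl rfl)]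
  · rw [A_mem_hexagon] at hA
    rw [B_mem_hexagon] at hB
    obtain ⟨rfl, rfl⟩ : c = a ∧ d = b := by omega
    exact .inr (.inr rfl)

/-- The path leaves `(a, b)` by a double bond down to the left or to the right, or jumps over the
sextet `(a, b)`. -/
theorem tailSum_eq (hP : ∀ p ∈ P, p ≤ t) (hab : (a, b) ∈ P) (ht : (a, b) ≠ t) :
    tailSum x P t (a, b) = tailSum x P t (a + 1, b) + tailSum x P t (a, b + 1) +
      if (a + 1, b) ∈ P ∧ (a, b + 1) ∈ P then x * tailSum x P t (a + 1, b + 1) else 0 := by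
  set U := region {p ∈ P | (a, b) ≤ p} (a, b) t with hU
  set L : Finset (Finset HexVertex) :=
    {{.A a b, .B (a + 1) b}, {.A a b, .B a (b + 1)}, hexagon (a, b)} with hL
  have hA : .A a b ∈ U := by simp [hU, hab, ht]
  have hedge {c d : ℕ} (hadj : honeycomb.Adj (.A a b) (.B c d)) (hlt : (a, b) < (c, d)) :
      (if {.A a b, .B c d} ⊆ U then clarWeight honeycomb x {.A a b, .B c d} *
        partitionSum (clarWeight honeycomb x) (U \ {.A a b, .B c d}) else 0) =
      tailSum x P t (c, d) := by
    split_ifs with h <;> rw [hU, edge_subset_region_iff hab ht hlt] at h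
    · rw [clarWeight_honeycomb_edge x hadj, one_mul, partitionSum_region_sdiff_edge x hP h hlt]
    · rw [tailSum_of_notMem x h]
  have hhexagon :
      (if hexagon (a, b) ⊆ U then clarWeight honeycomb x (hexagon (a, b)) *
        partitionSum (clarWeight honeycomb x) (U \ hexagon (a, b)) else 0) =
      if (a + 1, b) ∈ P ∧ (a, b + 1) ∈ P then x * tailSum x P t (a + 1, b + 1) else 0 := by
    by_cases hc : (a + 1, b + 1) ∈ P
    · simp only [hU, hexagon_subset_region_iff hP hab, hc, and_true, clarWeight_honeycomb_hexagon,
        partitionSum_region_sdiff_hexagon x hP hc]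
    · simp only [hU, hexagon_subset_region_iff hP hab, hc, and_false, if_false,
        tailSum_of_notMem x hc, mul_zero, ite_self]
  have hne : ({.A a b, .B (a + 1) b} : Finset HexVertex) ∉
      ({{.A a b, .B a (b + 1)}, hexagon (a, b)} : Finset (Finset HexVertex)) := by
    rw [Finset.mem_insert, Finset.mem_singleton, not_or]
    exact ⟨fun h => by simpa using h.le (Finset.mem_insert_of_mem (Finset.mem_singleton_self _)),
      pair_ne_hexagon⟩
  calc tailSum x P t (a, b)
      = ∑ τ ∈ L with τ ⊆ U, clarWeight honeycomb x τ *
          partitionSum (clarWeight honeycomb x) (U \ τ) := by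
        rw [tailSum, if_pos hab]
        refine partitionSum_eq_sum hA _ ?_ ?_
        · simp [hL]
        · intro τ hτU hAτ hτ
          simpa [hL, hτU] using edge_or_hexagon_of_source_mem x hτU hAτ hτ
    _ = _ := by
        rw [Finset.sum_filter, hL, Finset.sum_insert hne, Finset.sum_pair pair_ne_hexagon,
          ← add_assoc, hedge (by rw [honeycomb_adj_A_B]; omega) (by simp),
          hedge (by rw [honeycomb_adj_A_B]; omega) (by simp), hhexagon]

theorem tailSum_eq_delannoy {n m : ℕ} (hP : ∀ p ∈ P, p ≤ (a + n, b + m))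
    (hPt : Finset.Icc (a, b) (a + n, b + m) ⊆ P) :
    tailSum x P (a + n, b + m) (a, b) = delannoy x n m := by
  have hin {c d : ℕ} (hc : c ≤ n) (hd : d ≤ m) : (a + c, b + d) ∈ P := hPt (by simp [hc, hd])
  have hout {c d : ℕ} (h : n < c ∨ m < d) : (a + c, b + d) ∉ P := fun hc => by
    have := hP _ hc
    simp only [Prod.mk_le_mk] at this
    omega
  refine eq_delannoy (F := fun c d => tailSum x P (a + n, b + m) (a + c, b + d))
    (fun c d h => tailSum_of_notMem x (hout h)) (tailSum_sink x (hin le_rfl le_rfl) hP) ?_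
  intro c d hc hd hne
  rw [tailSum_eq x hP (hin hc hd) (by simpa using hne)]
  congr 1
  split_ifs with h
  · rfl
  · rw [tailSum_of_notMem x (hout _), mul_zero]
    by_contra hcd
    exact h ⟨hin (c := c + 1) (by omega) hd, hin (d := d + 1) hc (by omega)⟩

end Region

section Benzenoid

theorem exists_A_mem_hexagon_iff {S : Set (ℕ × ℕ)} {a b : ℕ} : (∃ h ∈ S, .A a b ∈ hexagon h) ↔
    (a, b) ∈ S ∨ (1 ≤ b ∧ (a, b - 1) ∈ S) ∨ (1 ≤ a ∧ (a - 1, b) ∈ S) := by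
  simp only [A_mem_hexagon]
  constructor
  · rintro ⟨⟨c, d⟩, h, hcd⟩
    obtain ⟨rfl, rfl⟩ | ⟨rfl, rfl⟩ | ⟨rfl, rfl⟩ :
      (c = a ∧ d = b) ∨ (a = c ∧ b = d + 1) ∨ (a = c + 1 ∧ b = d) := by omega
    all_goals simp [h]
  · rintro (h | ⟨_, h⟩ | ⟨_, h⟩) <;> exact ⟨_, h, by omega⟩

theorem exists_B_mem_hexagon_iff {S : Set (ℕ × ℕ)} {a b : ℕ} : (∃ h ∈ S, .B a b ∈ hexagon h) ↔
    (1 ≤ b ∧ (a, b - 1) ∈ S) ∨ (1 ≤ a ∧ 1 ≤ b ∧ (a - 1, b - 1) ∈ S) ∨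
      (1 ≤ a ∧ (a - 1, b) ∈ S) := by
  simp only [B_mem_hexagon]
  constructor
  · rintro ⟨⟨c, d⟩, h, hcd⟩
    obtain ⟨rfl, rfl⟩ | ⟨rfl, rfl⟩ | ⟨rfl, rfl⟩ :
      (a = c ∧ b = d + 1) ∨ (a = c + 1 ∧ b = d + 1) ∨ (a = c + 1 ∧ b = d) := by omega
    all_goals simp [h]
  · rintro (⟨_, h⟩ | ⟨_, _, h⟩ | ⟨_, h⟩) <;> exact ⟨_, h, by omega⟩

theorem zzPolynomial_benzenoid {S : Set (ℕ × ℕ)} {U : Finset HexVertex}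
    (hU : ∀ v, v ∈ U ↔ ∃ h ∈ S, v ∈ hexagon h)
    (hind : ∀ a b c d, honeycomb.Adj (.A a b) (.B c d) → .A a b ∈ U → .B c d ∈ U →
      ∃ h ∈ S, .A a b ∈ hexagon h ∧ .B c d ∈ hexagon h) :
    zzPolynomial (benzenoid S) = partitionSum (clarWeight honeycomb Polynomial.X) U := by
  have : Fintype {v : HexVertex // ∃ h ∈ S, v ∈ hexagon h} := Fintype.subtype U hU
  have hadj (u v) : honeycomb.Adj (u : {v // ∃ h ∈ S, v ∈ hexagon h}).1 v.1 ↔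
      (benzenoid S).Adj u v := by
    refine ⟨fun h => ⟨h, ?_⟩, fun h => h.1⟩
    obtain ⟨⟨a, b⟩ | ⟨a, b⟩, hu⟩ := u <;> obtain ⟨⟨c, d⟩ | ⟨c, d⟩, hv⟩ := v
    · simp at h
    · exact hind a b c d h ((hU _).mpr hu) ((hU _).mpr hv)
    · obtain ⟨g, hg, hA, hB⟩ := hind c d a b h.symm ((hU _).mpr hv) ((hU _).mpr hu)
      exact ⟨g, hg, hB, hA⟩
    · simp at h
  rw [zzPolynomial_eq_partitionSum ⟨.subtype _, hadj _ _⟩ sixCyclesInduced_honeycomb]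
  congr 1
  ext v
  simp [hU]

/-- Rectangles and ribbons are both L-shaped regions of this form. -/
theorem zzPolynomial_benzenoid_eq_tailSum {S : Set (ℕ × ℕ)} {P : Finset (ℕ × ℕ)}
    {r c N m M : ℕ} (hrc : r ≤ c) (hcN : c < N) (hm : 0 < m) (hmM : m ≤ M)
    (hS : ∀ h, h ∈ S ↔ r ≤ h.1 ∧ h.1 < N ∧ h.2 < M ∧ (h.1 < c → h.2 < m))
    (hP : ∀ p, p ∈ P ↔ r ≤ p.1 ∧ p.1 ≤ N ∧ p.2 ≤ M ∧ (p.1 < c → p.2 ≤ m)) :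
    zzPolynomial (benzenoid S) = tailSum Polynomial.X P (N, M) (r, 0) := by
  rw [tailSum, if_pos ((hP _).mpr ⟨le_rfl, by omega, M.zero_le, fun _ => m.zero_le⟩)]
  have hU (v) : v ∈ region {p ∈ P | (r, 0) ≤ p} (r, 0) (N, M) ↔ ∃ h ∈ S, v ∈ hexagon h := by
    rcases v with ⟨a, b⟩ | ⟨a, b⟩
    · rw [A_mem_region, exists_A_mem_hexagon_iff]
      simp only [Finset.mem_filter, hS, hP, ne_eq, Prod.mk.injEq, Prod.mk_le_mk]
      omega
    · rw [B_mem_region, exists_B_mem_hexagon_iff]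
      simp only [Finset.mem_filter, hS, hP, ne_eq, Prod.mk.injEq, Prod.mk_le_mk]
      omega
  refine zzPolynomial_benzenoid hU fun a b e f hadj hA hB => ?_
  suffices ∃ h ∈ {h ∈ S | .B e f ∈ hexagon h}, .A a b ∈ hexagon h by
    obtain ⟨h, ⟨hhS, hhB⟩, hhA⟩ := this
    exact ⟨h, hhS, hhA, hhB⟩
  rw [honeycomb_adj_A_B] at hadj
  rw [exists_A_mem_hexagon_iff]
  simp only [A_mem_region, B_mem_region, Finset.mem_filter, hP, ne_eq, Prod.mk.injEq,
    Prod.mk_le_mk] at hA hB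
  simp only [Set.mem_ofPred_eq, hS, B_mem_hexagon]
  omega

theorem zzPolynomial_benzenoid_empty : zzPolynomial (benzenoid ∅) = 1 := by
  rw [zzPolynomial_benzenoid (U := ∅) (by simp) (by simp), partitionSum_empty]

theorem zzPolynomial_benzenoid_rectangle {S : Set (ℕ × ℕ)} {r n m : ℕ}
    (hS : ∀ h, h ∈ S ↔ r ≤ h.1 ∧ h.1 < r + n ∧ h.2 < m) :
    zzPolynomial (benzenoid S) = delannoy Polynomial.X n m := by
  rcases Nat.eq_zero_or_pos n with rfl | hn
  · obtain rfl : S = ∅ := Set.eq_empty_of_forall_notMem fun h => by rw [hS]; omega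
    rw [zzPolynomial_benzenoid_empty, delannoy_zero_left]
  rcases Nat.eq_zero_or_pos m with rfl | hm
  · obtain rfl : S = ∅ := Set.eq_empty_of_forall_notMem fun h => by rw [hS]; omega
    rw [zzPolynomial_benzenoid_empty, delannoy_zero_right]
  rw [zzPolynomial_benzenoid_eq_tailSum (P := Finset.Icc (r, 0) (r + n, 0 + m)) (c := r)
    (N := r + n) (M := 0 + m) (m := m) le_rfl (by omega) hm (by omega) (fun h => by rw [hS]; omega)
    (fun _ => by simp only [Finset.mem_Icc, Prod.le_def]; omega),
    tailSum_eq_delannoy _ (fun _ hp => (Finset.mem_Icc.mp hp).2) subset_rfl]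

end Benzenoid

section Ribbon

/-- The positions of the vertices of a ribbon. -/
def ribbonPositions (n₁ n₂ m₁ m₂ : ℕ) : Finset (ℕ × ℕ) :=
  {p ∈ Finset.Icc 0 (n₂ + n₁, m₁ + m₂) | p.1 < n₂ → p.2 ≤ m₁}

theorem mem_ribbonPositions {n₁ n₂ m₁ m₂ a b : ℕ} :
    (a, b) ∈ ribbonPositions n₁ n₂ m₁ m₂ ↔ a ≤ n₂ + n₁ ∧ b ≤ m₁ + m₂ ∧ (a < n₂ → b ≤ m₁) := by
  simp [ribbonPositions, and_assoc]

theorem le_of_mem_ribbonPositions {n₁ n₂ m₁ m₂ : ℕ} :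
    ∀ p ∈ ribbonPositions n₁ n₂ m₁ m₂, p ≤ (n₂ + n₁, m₁ + m₂) := fun _ hp =>
  (Finset.mem_Icc.mp (Finset.mem_filter.mp hp).1).2

variable {R : Type*} [CommSemiring R] (x : R) {n₁ n₂ m₁ m₂ : ℕ}

variable (n₁ n₂ m₁ m₂) in
/-- The tail sums of a ribbon, cut off above `m₁`: up to the antidiagonal through the inner corner
`(n₂, m₁)`, the cut-off makes the recurrence `tailSum_eq` unconditional. -/
noncomputable def ribbonTailSum (a b : ℕ) : R :=
  if b ≤ m₁ then tailSum x (ribbonPositions n₁ n₂ m₁ m₂) (n₂ + n₁, m₁ + m₂) (a, b) else 0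

theorem ribbonTailSum_eq_zero {a b : ℕ} (h : n₂ + n₁ < a ∨ m₁ < b) :
    ribbonTailSum x n₁ n₂ m₁ m₂ a b = 0 := by
  refine ite_eq_right_iff.mpr fun hb => tailSum_of_notMem x ?_
  rw [mem_ribbonPositions]
  omega

theorem ribbonTailSum_eq (hn : 0 < n₁) {a b : ℕ} (hab : a + b < n₂ + m₁) :
    ribbonTailSum x n₁ n₂ m₁ m₂ a b = ribbonTailSum x n₁ n₂ m₁ m₂ (a + 1) b +
      ribbonTailSum x n₁ n₂ m₁ m₂ a (b + 1) + x * ribbonTailSum x n₁ n₂ m₁ m₂ (a + 1) (b + 1) := by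
  have hzero {c d : ℕ} (h : n₂ + n₁ < c ∨ m₁ < d) : ribbonTailSum x n₁ n₂ m₁ m₂ c d = 0 :=
    ribbonTailSum_eq_zero x h
  have hpos {c d : ℕ} (hd : d ≤ m₁) : ribbonTailSum x n₁ n₂ m₁ m₂ c d =
      tailSum x (ribbonPositions n₁ n₂ m₁ m₂) (n₂ + n₁, m₁ + m₂) (c, d) := if_pos hd
  by_cases h : n₂ + n₁ < a ∨ m₁ < b
  · rw [hzero h, hzero (c := a + 1) (by omega), hzero (d := b + 1) (by omega),
      hzero (c := a + 1) (d := b + 1) (by omega), mul_zero, add_zero, add_zero]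
  have hab_mem : (a, b) ∈ ribbonPositions n₁ n₂ m₁ m₂ := mem_ribbonPositions.mpr (by omega)
  have hsink : (a, b) ≠ (n₂ + n₁, m₁ + m₂) := by
    rw [ne_eq, Prod.mk.injEq]
    omega
  rw [hpos (by omega), tailSum_eq x le_of_mem_ribbonPositions hab_mem hsink, hpos (by omega)]
  rcases eq_or_ne b m₁ with rfl | hb
  · have hright : (a, b + 1) ∉ ribbonPositions n₁ n₂ b m₂ := by
      rw [mem_ribbonPositions]
      omega
    rw [tailSum_of_notMem x hright, if_neg (mt And.right hright), hzero (d := b + 1) (by omega),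
      hzero (d := b + 1) (by omega), mul_zero]
  · rw [hpos (d := b + 1) (by omega)]
    congr 1
    split_ifs with hcell
    · rw [hpos (by omega)]
    · rw [hzero, mul_zero]
      rw [mem_ribbonPositions, mem_ribbonPositions] at hcell
      omega

theorem ribbonTailSum_eq_delannoy {k l : ℕ} (hk : k ≤ n₁) (hl : l ≤ m₁) :
    ribbonTailSum x n₁ n₂ m₁ m₂ (n₂ + k) (m₁ - l) = delannoy x (m₂ + l) (n₁ - k) := by
  have hsink : (n₂ + n₁, m₁ + m₂) = (n₂ + k + (n₁ - k), m₁ - l + (m₂ + l)) := by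
    rw [Prod.mk.injEq]
    omega
  have hP := le_of_mem_ribbonPositions (n₁ := n₁) (n₂ := n₂) (m₁ := m₁) (m₂ := m₂)
  rw [ribbonTailSum, if_pos (m₁.sub_le l), delannoy_comm]
  rw [hsink] at hP ⊢
  refine tailSum_eq_delannoy x hP fun ⟨a, b⟩ hab => mem_ribbonPositions.mpr ?_
  simp only [Finset.mem_Icc, Prod.mk_le_mk] at hab
  omega

theorem ribbonTailSum_zero_zero (hn : 0 < n₁) (hm : 0 < m₁) :
    ribbonTailSum x n₁ n₂ m₁ m₂ 0 0 =
      ∑ k ∈ Finset.Icc 0 (min n₁ m₁),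
        delannoy x (n₂ + k) (m₁ - k) * delannoy x (m₂ + k) (n₁ - k) +
      x * ∑ k ∈ Finset.Icc 1 (min n₁ m₁),
        delannoy x (n₂ + k - 1) (m₁ - k) * delannoy x (m₂ + k - 1) (n₁ - k) := by
  have hcross := sum_antidiagonal_eq_sum_Icc (c := n₂) (m := m₁) (r := 0) (N := n₁)
    (d := n₂ + m₁ - 1 + 1) (by omega)
    (fun a b => delannoy x a b * ribbonTailSum x n₁ n₂ m₁ m₂ a b)
    fun a b _ h => by rw [ribbonTailSum_eq_zero x (by omega), mul_zero]
  have hjump := sum_antidiagonal_eq_sum_Icc (c := n₂) (m := m₁) (r := 1) (N := n₁)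
    (d := n₂ + m₁ - 1) (by omega)
    (fun a b => delannoy x a b * ribbonTailSum x n₁ n₂ m₁ m₂ (a + 1) (b + 1))
    fun a b _ h => by rw [ribbonTailSum_eq_zero x (by omega), mul_zero]
  rw [eq_sum_antidiagonal_delannoy (F := ribbonTailSum x n₁ n₂ m₁ m₂) (d := n₂ + m₁ - 1)
    fun a b hab => ribbonTailSum_eq x hn (by omega), hcross, hjump]
  congr 1
  · refine Finset.sum_congr rfl fun k hk => ?_
    rw [Finset.mem_Icc] at hk
    rw [Nat.sub_zero, ribbonTailSum_eq_delannoy x (by omega) (by omega)]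
  · refine congr_arg (x * ·) (Finset.sum_congr rfl fun k hk => ?_)
    rw [Finset.mem_Icc] at hk
    have hright : n₂ + k - 1 + 1 = n₂ + k := by omega
    have hup : m₁ - k + 1 = m₁ - (k - 1) := by omega
    rw [hright, hup, ribbonTailSum_eq_delannoy x (by omega) (by omega),
      Nat.add_sub_assoc hk.1 m₂]

theorem zzPolynomial_ribbon (n₁ n₂ m₁ m₂ : ℕ) :
    zzPolynomial (ribbon n₁ n₂ m₁ m₂) =
      ∑ k ∈ Finset.Icc 0 (min n₁ m₁),
        delannoy Polynomial.X (n₂ + k) (m₁ - k) * delannoy Polynomial.X (m₂ + k) (n₁ - k) +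
      Polynomial.X * ∑ k ∈ Finset.Icc 1 (min n₁ m₁),
        delannoy Polynomial.X (n₂ + k - 1) (m₁ - k) *
          delannoy Polynomial.X (m₂ + k - 1) (n₁ - k) := by
  rcases Nat.eq_zero_or_pos n₁ with rfl | hn
  · rw [zzPolynomial_benzenoid_rectangle (r := 0) (n := n₂) (m := m₁)]
    · simp
    · intro h
      simp only [ribbonCells, Set.mem_ofPred_eq]
      omega
  rcases Nat.eq_zero_or_pos m₁ with rfl | hm
  · rw [zzPolynomial_benzenoid_rectangle (r := n₂) (n := n₁) (m := m₂)]
    · simp [delannoy_comm Polynomial.X n₁]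
    · intro h
      simp only [ribbonCells, Set.mem_ofPred_eq]
      omega
  rw [← ribbonTailSum_zero_zero Polynomial.X hn hm, ribbonTailSum, if_pos m₁.zero_le]
  refine zzPolynomial_benzenoid_eq_tailSum (c := n₂) (m := m₁) n₂.zero_le (by omega) hm
    (by omega) (fun h => ?_) fun ⟨a, b⟩ => ?_
  · simp only [ribbonCells, Set.mem_ofPred_eq]
    omega
  · rw [mem_ribbonPositions]
    omega

theorem finite_ribbon_vertices (n₁ n₂ m₁ m₂ : ℕ) :
    Finite {v : HexVertex // ∃ h ∈ ribbonCells n₁ n₂ m₁ m₂, v ∈ hexagon h} := by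
  have hS : (ribbonCells n₁ n₂ m₁ m₂).Finite :=
    (Set.finite_Iic (n₂ + n₁, m₁ + m₂)).subset fun h hh => by
      simp only [ribbonCells, Set.mem_ofPred_eq] at hh
      simp only [Set.mem_Iic, Prod.le_def]
      omega
  exact Finite.of_equiv (hS.toFinset.biUnion hexagon) (Equiv.subtypeEquivRight (by simp))

end Ribbon

theorem mainTheorem2 (n₁ n₂ m₁ m₂ : ℕ) :
    (numKekule (ribbon n₁ n₂ m₁ m₂) = (zzPolynomial (ribbon n₁ n₂ m₁ m₂)).eval 0 ∧
      numKekule (ribbon n₁ n₂ m₁ m₂) =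
        ∑ k ∈ Finset.Icc 0 (min n₁ m₁),
          ∑ j ∈ Finset.Icc 0 (m₁ - k), ∑ i ∈ Finset.Icc 0 (n₁ - k),
            (m₁ - k).choose j * (n₂ + k).choose j *
              ((m₂ + k).choose i * (n₁ - k).choose i)) ∧
    (numClarCovers (ribbon n₁ n₂ m₁ m₂) = (zzPolynomial (ribbon n₁ n₂ m₁ m₂)).eval 1 ∧
      numClarCovers (ribbon n₁ n₂ m₁ m₂) =
        ∑ k ∈ Finset.Icc 0 (min n₁ m₁),
          ∑ j ∈ Finset.Icc 0 (m₁ - k), ∑ i ∈ Finset.Icc 0 (n₁ - k),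
            (m₁ - k).choose j * (n₂ + k).choose j *
              ((m₂ + k).choose i * (n₁ - k).choose i) * 2 ^ (i + j) +
        ∑ k ∈ Finset.Icc 1 (min n₁ m₁),
          ∑ j ∈ Finset.Icc 0 (m₁ - k), ∑ i ∈ Finset.Icc 0 (n₁ - k),
            (m₁ - k).choose j * (n₂ + k - 1).choose j *
              ((m₂ + k - 1).choose i * (n₁ - k).choose i) * 2 ^ (i + j)) := by
  have := finite_ribbon_vertices n₁ n₂ m₁ m₂
  have hK := congr_arg (Polynomial.eval 0) (zzPolynomial_ribbon n₁ n₂ m₁ m₂)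
  have hC := congr_arg (Polynomial.eval 1) (zzPolynomial_ribbon n₁ n₂ m₁ m₂)
  simp only [Polynomial.eval_add, Polynomial.eval_mul, Polynomial.eval_finsetSum, eval_delannoy,
    Polynomial.eval_X] at hK hC
  refine ⟨⟨numKekule_eq_eval_zzPolynomial _, ?_⟩, numClarCovers_eq_eval_zzPolynomial _, ?_⟩
  · rw [numKekule_eq_eval_zzPolynomial, hK]
    simp [delannoy_mul_delannoy]
  · rw [numClarCovers_eq_eval_zzPolynomial, hC]
    simp [delannoy_mul_delannoy, one_add_one_eq_two]
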